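/- For a smooth map $g$ defined near $0\in\mathbb{C}\cong\mathbb{R}^2$ with values in $\mathbb{R}$ or $\mathbb{C}^N$, let $\mathrm{ord}_0(g)\in\{0,1,2,\dots\}\cup\{\infty\}$ be the least $k$ such that some partial derivative of $g$ of order $k$ is non-zero at $0$ ($\infty$ if there is none). For a smooth real function $k$ defined near $p\in\mathbb{C}^N$, the type of $k$ at $p$ is $$\mathrm{typ}_p(k)=\sup_{\varphi}\frac{\mathrm{ord}_0\big(\zeta\mapsto k(p+\varphi(\zeta))\big)}{\mathrm{ord}_0(\varphi)},$$ the supremum being over all holomorphic maps $\varphi\not\equiv 0$ from the unit disc of $\mathbb{C}$ to $\mathbb{C}^N$ with $\varphi(0)=0$; $k$ is of finite type at $p$ if $\mathrm{typ}_p(k)<\infty$. A set $M$ that is a smooth real hypersurface near $p\in M$ is of finite type $t$ at $p$ if $t<\infty$ and $\mathrm{typ}_p(r)=t$ for the smooth local defining functions $r$ of $M$ near $p$ (that is, $M=\{r=0\}$ near $p$ and $\nabla r\neq 0$). **Proposition.** Let $z_0\in\mathbb{C}^n$, let $U\subset\mathbb{C}^n$ be an open neighbourhood of $z_0$ and $V\subset\mathbb{C}^m$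 an open neighbourhood of $0$. Let $\rho:U\to\mathbb{R}$ be a $\mathcal{C}^\infty$ function with $\rho(z_0)=0$ and $\nabla\rho\neq 0$ everywhere on $U$, and let $h:V\to[0,\infty)$ be a $\mathcal{C}^\infty$ function such that, for $w\in V$, $h(w)\neq 0$ if and only if $w\neq 0$, and $\nabla h(w)\neq 0$ if $w\neq 0$. Put $\partial G=\{z\in U:\rho(z)=0\}$ and assume that at every point of $\partial G$ the Levi form $i\partial\overline\partial\rho$ is non-negative on the complex tangent space of $\partial G$, that is, $\sum_{j,k}\frac{\partial^2\rho}{\partial z_j\partial\overline z_k}(z)v_j\overline{v_k}\ge 0$ for all $z\in\partial G$ and all $v\in\mathbb{C}^n$ with $\sum_j\frac{\partial\rho}{\partial z_j}(z)v_j=0$. Assume that $\partial G$ is of finite type $\tau$ at $z_0$ and that $h$ is of finite type $\mathrm{typ}_0(h)$ at $0$. Then the boundary of $$\widetilde G=\{(z,w)\in U\times V:\rho(z)+h(w)<0\}$$ is, near $(z_0,0)$, a smooth real hypersurface, and it is of finite type exactly $\max(\tau,\mathrm{typ}_0(h))$ at $(z_0,0)$. -/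

import Mathlib

open scoped ENNReal ContDiff

noncomputable section

namespace FiniteType

/-- The order of `g` at `x`: the least `k` such that some partial derivative of `g` of order `k`
does not vanish at `x` (that is, such that the `k`-th derivative of `g` at `x`, as a multilinear
map, is nonzero), and `⊤` if there is none. -/
def order {D F : Type*} [NormedAddCommGroup D] [NormedSpace ℝ D]
    [NormedAddCommGroup F] [NormedSpace ℝ F] (g : D → F) (x : D) : ℕ∞ :=
  ⨅ (k : ℕ) (_ : iteratedFDeriv ℝ k g x ≠ 0), (k : ℕ∞)

/-- `φ` is a holomorphic map on the unit disc of the complex plane with `φ 0 = 0` that is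
not identically zero there (its values outside the unit disc are irrelevant). -/
structure IsDisc {E : Type*} [NormedAddCommGroup E] [NormedSpace ℂ E] (φ : ℂ → E) : Prop where
  holomorphic : DifferentiableOn ℂ φ (Metric.ball 0 1)
  map_zero : φ 0 = 0
  nonzero : ∃ ζ ∈ Metric.ball (0 : ℂ) 1, φ ζ ≠ 0

/-- The type of the function `k` at the point `p`: the supremum of
`order (k (p + φ ·)) / order φ` (orders at the origin) over all nonzero holomorphic maps `φ`
on the unit disc with `φ 0 = 0`. -/
def typeAt {E : Type*} [NormedAddCommGroup E] [NormedSpace ℝ E] [NormedSpace ℂ E]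
    (k : E → ℝ) (p : E) : ℝ≥0∞ :=
  ⨆ (φ : ℂ → E) (_ : IsDisc φ),
    (order (fun ζ => k (p + φ ζ)) 0 : ℝ≥0∞) / (order φ 0 : ℝ≥0∞)

/-- `r` is a smooth local defining function, near the point `p` of `M`, of the set `M`. -/
def IsLocalDefiningFunction {E : Type*} [NormedAddCommGroup E] [NormedSpace ℝ E]
    (M : Set E) (p : E) (r : E → ℝ) : Prop :=
  p ∈ M ∧ ∃ W : Set E, IsOpen W ∧ p ∈ W ∧ ContDiffOn ℝ ∞ r W ∧
    (∀ x ∈ W, fderiv ℝ r x ≠ 0) ∧ ∀ x ∈ W, (x ∈ M ↔ r x = 0)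

/-- Near its point `p` the set `M` is a smooth real hypersurface, and it is of finite type `t`
at `p`: the number `t` is finite, and it is the type at `p` of the local defining functions
of `M` near `p`. -/
def IsOfFiniteType {E : Type*} [NormedAddCommGroup E] [NormedSpace ℝ E] [NormedSpace ℂ E]
    (M : Set E) (p : E) (t : ℝ≥0∞) : Prop :=
  t < ⊤ ∧ (∃ r : E → ℝ, IsLocalDefiningFunction M p r) ∧
    ∀ r : E → ℝ, IsLocalDefiningFunction M p r → typeAt r p = t

/-- The Levi form `∑ j k, (∂² ρ / ∂ z_j ∂ z̄_k) (z) v_j v̄_k` of `ρ` at `z` in the direction `v`,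
written with the real second derivative:
it is a quarter of the Laplacian of `ζ ↦ ρ (z + ζ v)` at the origin. -/
def leviForm {E : Type*} [NormedAddCommGroup E] [NormedSpace ℝ E] [NormedSpace ℂ E]
    (ρ : E → ℝ) (z v : E) : ℝ :=
  (fderiv ℝ (fderiv ℝ ρ) z v v +
    fderiv ℝ (fderiv ℝ ρ) z (Complex.I • v) (Complex.I • v)) / 4

/-- `v` is complex tangent at `z` to the level set of `ρ` through `z`: both `v` and `i v` are
tangent, that is, `∑ j, (∂ ρ / ∂ z_j) (z) v_j = 0`. -/
def IsComplexTangent {E : Type*} [NormedAddCommGroup E] [NormedSpace ℝ E] [NormedSpace ℂ E]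
    (ρ : E → ℝ) (z v : E) : Prop :=
  fderiv ℝ ρ z v = 0 ∧ fderiv ℝ ρ z (Complex.I • v) = 0

end FiniteType

end

/-!
Along a holomorphic curve `ζ ↦ (ψ ζ, χ ζ)` the only way the order of `ρ ∘ ψ + h ∘ χ` could exceed
the minimum of the orders of `ρ ∘ ψ` and `h ∘ χ` is that their leading homogeneous parts cancel.
Since `h ≥ 0`, the leading part of `h ∘ χ` is nonnegative, so that of `ρ ∘ ψ` would be nonpositive.
Pseudoconvexity makes the leading part of `ρ ∘ ψ` subharmonic: the Levi form of `ρ` at `z` in the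
direction `v` is bounded below by `-C (|ρ| |v| + |∂ρ(v)|) |v|`, and along `ψ` this error is of
higher order than the Levi form of the leading part. A nonpositive subharmonic function on the plane
that is homogeneous of positive degree vanishes, so there is no cancellation. The orders
are those of any defining function, as a smooth function that vanishes on `{r = 0}` is `O(r)`.
-/

noncomputable section

namespace FiniteType

open Filter Topology Asymptotics

section Symmetry

variable {D F : Type*} [NormedAddCommGroup D] [NormedSpace ℝ D]
  [NormedAddCommGroup F] [NormedSpace ℝ F]

theorem iteratedFDeriv_comp_swap_succ {n : ℕ} {g : D → F} {x : D}
    (hg : ContDiffAt ℝ (n + 1) g x) (i : Fin n) (v : Fin (n + 1) → D) :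
    iteratedFDeriv ℝ (n + 1) g x (v ∘ Equiv.swap i.castSucc i.succ) =
      iteratedFDeriv ℝ (n + 1) g x v := by
  induction n generalizing x with
  | zero => exact i.elim0
  | succ n ih =>
    cases i using Fin.cases with
    | zero =>
      have hsmooth : ContDiffAt ℝ 2 (iteratedFDeriv ℝ n g) x :=
        hg.iteratedFDeriv_right (by norm_cast; omega)
      have hsymm : IsSymmSndFDerivAt ℝ (iteratedFDeriv ℝ n g) x :=
        hsmooth.isSymmSndFDerivAt (by simp)
      have hdiff : DifferentiableAt ℝ (fderiv ℝ (iteratedFDeriv ℝ n g)) x :=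
        (hsmooth.fderiv_right (m := 1) (by norm_num)).differentiableAt (by simp)
      have happly (w : Fin (n + 2) → D) : iteratedFDeriv ℝ (n + 2) g x w =
          fderiv ℝ (fderiv ℝ (iteratedFDeriv ℝ n g)) x (w 0) (w 1) (Fin.tail (Fin.tail w)) := by
        rw [iteratedFDeriv_succ_apply_left, ← fderiv_continuousMultilinear_apply_const_apply
          (hg.differentiableAt_iteratedFDeriv (by norm_cast; omega))]
        simp only [iteratedFDeriv_succ_apply_left]
        rw [fderiv_continuousMultilinear_apply_const_apply
          (hdiff.clm_apply (differentiableAt_const _)),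
          fderiv_clm_apply hdiff (differentiableAt_const _)]
        simp [Fin.tail]
      rw [happly, happly, hsymm.eq (v 0) (v 1)]
      congr 1
    | succ j =>
      have htail : Fin.tail (v ∘ Equiv.swap j.succ.castSucc j.succ.succ) =
          Fin.tail v ∘ Equiv.swap j.castSucc j.succ := by
        ext k
        simp only [Fin.tail, Function.comp_apply, ← Fin.succ_castSucc]
        rw [(Fin.succ_injective _).swap_apply]
      have hinv :
          (fun y => iteratedFDeriv ℝ (n + 1) g y (Fin.tail v ∘ Equiv.swap j.castSucc j.succ))
          =ᶠ[𝓝 x] fun y => iteratedFDeriv ℝ (n + 1) g y (Fin.tail v) := by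
        filter_upwards [hg.eventually (by simp)] with y hy
        exact ih (hy.of_le (by norm_cast; omega)) j _
      have hdiff : DifferentiableAt ℝ (iteratedFDeriv ℝ (n + 1) g) x :=
        hg.differentiableAt_iteratedFDeriv (by norm_cast; omega)
      rw [iteratedFDeriv_succ_apply_left, iteratedFDeriv_succ_apply_left, htail,
        ← fderiv_continuousMultilinear_apply_const_apply hdiff, hinv.fderiv_eq,
        fderiv_continuousMultilinear_apply_const_apply hdiff]
      simp [Equiv.swap_apply_of_ne_of_ne, Fin.ext_iff]

theorem iteratedFDeriv_comp_perm {n : ℕ} {g : D → F} {x : D} (hg : ContDiffAt ℝ n g x)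
    (v : Fin n → D) (σ : Equiv.Perm (Fin n)) :
    iteratedFDeriv ℝ n g x (v ∘ σ) = iteratedFDeriv ℝ n g x v := by
  cases n with
  | zero => simp [Subsingleton.elim (v ∘ σ) v]
  | succ n =>
    have hσ : σ ∈ Submonoid.closure
        (Set.range fun i : Fin n => Equiv.swap i.castSucc i.succ) := by
      rw [Equiv.Perm.mclosure_swap_castSucc_succ]
      exact Submonoid.mem_top σ
    induction hσ using Submonoid.closure_induction generalizing v with
    | mem σ hσ =>
      obtain ⟨i, rfl⟩ := hσ
      exact iteratedFDeriv_comp_swap_succ (mod_cast hg) i v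
    | one => rfl
    | mul σ τ _ _ hσ hτ =>
      rw [← hσ v, ← hτ (v ∘ σ)]
      rfl

end Symmetry

section Order

variable {D F G : Type*} [NormedAddCommGroup D] [NormedSpace ℝ D]
  [NormedAddCommGroup F] [NormedSpace ℝ F] [NormedAddCommGroup G] [NormedSpace ℝ G]

theorem le_order_iff {g : D → F} {x : D} {N : ℕ} :
    (N : ℕ∞) ≤ order g x ↔ ∀ k < N, iteratedFDeriv ℝ k g x = 0 := by
  simp only [order, le_iInf_iff, Nat.cast_le]
  exact forall_congr' fun k => by rw [← not_imp_not, not_le, not_not]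

theorem succ_le_order_iff {g : D → F} {x : D} {N : ℕ} (hN : (N : ℕ∞) ≤ order g x) :
    ((N + 1 : ℕ) : ℕ∞) ≤ order g x ↔ iteratedFDeriv ℝ N g x = 0 := by
  rw [le_order_iff] at hN ⊢
  refine ⟨fun h => h N N.lt_succ_self, fun h k hk => ?_⟩
  rcases Nat.lt_succ_iff_lt_or_eq.1 hk with hk | rfl
  exacts [hN k hk, h]

theorem order_congr {g g' : D → F} {x : D} (hgg' : g =ᶠ[𝓝 x] g') : order g x = order g' x := by
  simp only [order, (hgg'.iteratedFDeriv ℝ _).self_of_nhds]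

theorem order_fun_zero (x : D) : order (fun _ => (0 : F)) x = ⊤ := by
  simp [order]

theorem order_prodMk {f : D → F} {g : D → G} {x : D} (hf : ContDiffAt ℝ ∞ f x)
    (hg : ContDiffAt ℝ ∞ g x) :
    order (fun y => (f y, g y)) x = min (order f x) (order g x) := by
  have hprod (k : ℕ) : iteratedFDeriv ℝ k (fun y => (f y, g y)) x = 0 ↔
      iteratedFDeriv ℝ k f x = 0 ∧ iteratedFDeriv ℝ k g x = 0 := by
    rw [iteratedFDeriv_prodMk hf hg (mod_cast le_top)]
    simp [ContinuousMultilinearMap.ext_iff, forall_and]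
  refine ENat.eq_of_forall_natCast_le_iff fun N => ?_
  simp only [le_min_iff, le_order_iff, hprod, ← forall_and]

theorem isBigO_pow_succ_of_fderiv {g : D → F} {x : D} {k : ℕ}
    (hg : ∀ᶠ y in 𝓝 x, DifferentiableAt ℝ g y) (hx : g x = 0)
    (hO : fderiv ℝ g =O[𝓝 x] fun y => ‖y - x‖ ^ k) :
    g =O[𝓝 x] fun y => ‖y - x‖ ^ (k + 1) := by
  obtain ⟨C, hC, hbound⟩ := hO.exists_pos
  obtain ⟨ε, hε, hball⟩ := Metric.eventually_nhds_iff_ball.1 (hg.and hbound.bound)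
  refine IsBigO.of_bound C ?_
  filter_upwards [Metric.ball_mem_nhds x hε] with y hy
  have hsub : Metric.closedBall x ‖y - x‖ ⊆ Metric.ball x ε :=
    Metric.closedBall_subset_ball (by rwa [← mem_ball_iff_norm])
  have hderiv : ∀ z ∈ Metric.closedBall x ‖y - x‖, ‖fderiv ℝ g z‖ ≤ C * ‖y - x‖ ^ k := by
    intro z hz
    refine (hball z (hsub hz)).2.trans ?_
    rw [norm_pow, norm_norm]
    have := mem_closedBall_iff_norm.1 hz
    gcongr
  have hmean := (convex_closedBall x ‖y - x‖).norm_image_sub_le_of_norm_fderiv_le (𝕜 := ℝ)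
    (fun z hz => (hball z (hsub hz)).1) hderiv (Metric.mem_closedBall_self (norm_nonneg _))
    (mem_closedBall_iff_norm.2 le_rfl)
  rw [hx, sub_zero] at hmean
  rwa [norm_pow, norm_norm, pow_succ, ← mul_assoc]

theorem iteratedFDeriv_isBigO_of_le_order {g : D → F} {x : D} {N j k : ℕ}
    (hg : ContDiffAt ℝ N g x) (hN : (N : ℕ∞) ≤ order g x) (hjk : j + k = N) :
    iteratedFDeriv ℝ j g =O[𝓝 x] fun y => ‖y - x‖ ^ k := by
  induction k generalizing j with
  | zero =>
    have hcont : ContDiffAt ℝ 0 (iteratedFDeriv ℝ j g) x :=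
      hg.iteratedFDeriv_right (by simp [← hjk])
    simpa using hcont.continuousAt.isBigO_one ℝ
  | succ k ih =>
    have hdiff : ∀ᶠ y in 𝓝 x, DifferentiableAt ℝ (iteratedFDeriv ℝ j g) y :=
      (hg.eventually (by simp)).mono fun y hy =>
        hy.differentiableAt_iteratedFDeriv (by norm_cast; omega)
    have hderiv : fderiv ℝ (iteratedFDeriv ℝ j g) =O[𝓝 x] fun y => ‖y - x‖ ^ k := by
      have hle : fderiv ℝ (iteratedFDeriv ℝ j g) =O[𝓝 x] iteratedFDeriv ℝ (j + 1) g :=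
        IsBigO.of_bound 1 (.of_forall fun y => by rw [norm_fderiv_iteratedFDeriv, one_mul])
      exact hle.trans (ih (by omega))
    exact isBigO_pow_succ_of_fderiv hdiff (le_order_iff.1 hN j (by omega)) hderiv

theorem isBigO_of_le_order {g : D → F} {x : D} {N : ℕ} (hg : ContDiffAt ℝ N g x)
    (hN : (N : ℕ∞) ≤ order g x) : g =O[𝓝 x] fun y => ‖y - x‖ ^ N := by
  have hO := (iteratedFDeriv_isBigO_of_le_order hg hN (zero_add N)).norm_left
  simpa only [norm_iteratedFDeriv_zero, isBigO_norm_left] using hO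

end Order

section HomogeneousPart

variable {D F : Type*} [NormedAddCommGroup D] [NormedSpace ℝ D]
  [NormedAddCommGroup F] [NormedSpace ℝ F]

theorem iteratedFDeriv_zero_of_homogeneous {Q : D → F} {k N : ℕ} (hQ : ContDiff ℝ k Q)
    (hhom : ∀ (t : ℝ) v, Q (t • v) = t ^ N • Q v) (hk : k ≠ N) : iteratedFDeriv ℝ k Q 0 = 0 := by
  have hscale : (2 : ℝ) ^ k • iteratedFDeriv ℝ k Q 0 = (2 : ℝ) ^ N • iteratedFDeriv ℝ k Q 0 := by
    have hcomp := ((2 : ℝ) • ContinuousLinearMap.id ℝ D).iteratedFDeriv_comp_right hQ 0 le_rfl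
    have hQ2 : Q ∘ ((2 : ℝ) • ContinuousLinearMap.id ℝ D) = (2 : ℝ) ^ N • Q := funext (hhom 2)
    rw [hQ2, iteratedFDeriv_const_smul_apply hQ.contDiffAt, map_zero] at hcomp
    rw [hcomp]
    ext v
    simp [ContinuousMultilinearMap.map_smul_univ]
  have hne : (2 : ℝ) ^ k ≠ 2 ^ N := fun h => hk (pow_right_injective₀ two_pos (by norm_num) h)
  exact (smul_eq_zero.1 (by rw [sub_smul, hscale, sub_self])).resolve_left (sub_ne_zero.2 hne)

/-- The homogeneous part of degree `N` in the Taylor expansion of `g` at `x`, as a function of the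
increment. -/
def homogeneousPart (g : D → F) (x : D) (N : ℕ) (v : D) : F :=
  (N.factorial : ℝ)⁻¹ • iteratedFDeriv ℝ N g x fun _ => v

theorem homogeneousPart_smul (g : D → F) (x : D) (N : ℕ) (t : ℝ) (v : D) :
    homogeneousPart g x N (t • v) = t ^ N • homogeneousPart g x N v := by
  have := (iteratedFDeriv ℝ N g x).map_smul_univ (fun _ => t) fun _ => v
  simp only [homogeneousPart, this, Finset.prod_const, Finset.card_univ, Fintype.card_fin]
  exact smul_comm _ _ _

theorem homogeneousPart_add {f g : D → F} {x : D} {N : ℕ} (hf : ContDiffAt ℝ N f x)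
    (hg : ContDiffAt ℝ N g x) (v : D) :
    homogeneousPart (fun y => f y + g y) x N v =
      homogeneousPart f x N v + homogeneousPart g x N v := by
  rw [homogeneousPart, fun_iteratedFDeriv_add_apply hf hg, _root_.add_apply, smul_add]
  rfl

theorem contDiff_homogeneousPart (g : D → F) (x : D) (N : ℕ) {k : ℕ∞ω} :
    ContDiff ℝ k (homogeneousPart g x N) := by
  have := (iteratedFDeriv ℝ N g x).contDiff (n := k)
  unfold homogeneousPart
  fun_prop

theorem iteratedFDeriv_homogeneousPart {g : D → F} {x : D} {N : ℕ} (hg : ContDiffAt ℝ N g x) :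
    iteratedFDeriv ℝ N (homogeneousPart g x N) 0 = iteratedFDeriv ℝ N g x := by
  ext v
  have hdiag : ContDiff ℝ N fun v => iteratedFDeriv ℝ N g x fun _ => v := by
    have := (iteratedFDeriv ℝ N g x).contDiff (n := N)
    fun_prop
  have hsymm (σ : Equiv.Perm (Fin N)) :
      iteratedFDeriv ℝ N g x (fun i => v (σ i)) = iteratedFDeriv ℝ N g x v :=
    iteratedFDeriv_comp_perm hg v σ
  have hsmul : homogeneousPart g x N =
      (N.factorial : ℝ)⁻¹ • fun v => iteratedFDeriv ℝ N g x fun _ => v := rfl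
  rw [hsmul, iteratedFDeriv_const_smul_apply hdiag.contDiffAt, _root_.smul_apply,
    ContinuousMultilinearMap.iteratedFDeriv_comp_diagonal]
  simp only [hsymm, Finset.sum_const, Finset.card_univ, Fintype.card_perm, Fintype.card_fin]
  rw [← Nat.cast_smul_eq_nsmul ℝ, inv_smul_smul₀ (by positivity)]

theorem succ_le_order_iff_homogeneousPart_eq_zero {g : D → F} {x : D} {N : ℕ}
    (hg : ContDiffAt ℝ N g x) (hN : (N : ℕ∞) ≤ order g x) :
    ((N + 1 : ℕ) : ℕ∞) ≤ order g x ↔ homogeneousPart g x N = 0 := by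
  rw [succ_le_order_iff hN]
  refine ⟨fun h => ?_, fun h => ?_⟩
  · ext v
    simp [homogeneousPart, h]
  · rw [← iteratedFDeriv_homogeneousPart hg, h]
    exact congrFun iteratedFDeriv_fun_zero _

theorem succ_le_order_sub_homogeneousPart {g : D → F} {x : D} {N : ℕ}
    (hg : ContDiffAt ℝ N g x) (hN : (N : ℕ∞) ≤ order g x) :
    ((N + 1 : ℕ) : ℕ∞) ≤ order (fun y => g y - homogeneousPart g x N (y - x)) x := by
  refine le_order_iff.2 fun k hk => ?_
  have hk : k ≤ N := Nat.lt_succ_iff.1 hk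
  have hQ := contDiff_homogeneousPart g x N (k := k)
  rw [fun_iteratedFDeriv_sub_apply (hg.of_le (mod_cast hk)) (by fun_prop),
    iteratedFDeriv_comp_sub k x x, sub_self, sub_eq_zero]
  rcases hk.lt_or_eq with hk | rfl
  · rw [le_order_iff.1 hN k hk,
      iteratedFDeriv_zero_of_homogeneous hQ (homogeneousPart_smul g x N) hk.ne]
  · exact (iteratedFDeriv_homogeneousPart hg).symm

theorem sub_homogeneousPart_isBigO {g : D → F} {x : D} {N : ℕ}
    (hg : ContDiffAt ℝ (N + 1 : ℕ) g x) (hN : (N : ℕ∞) ≤ order g x) :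
    (fun v => g (x + v) - homogeneousPart g x N v) =O[𝓝 0] fun v => ‖v‖ ^ (N + 1) := by
  have hQ := contDiff_homogeneousPart g x N (k := (N + 1 : ℕ))
  have hO := isBigO_of_le_order (hg.sub (by fun_prop))
    (succ_le_order_sub_homogeneousPart (hg.of_le (by norm_cast; omega)) hN)
  rw [← map_add_left_nhds_zero, isBigO_map] at hO
  simpa [Function.comp_def] using hO

theorem nonneg_of_homogeneous_of_isBigO_le {P r : D → ℝ} {N : ℕ}
    (hP : ∀ t : ℝ, 0 < t → ∀ v, P (t • v) = t ^ N * P v) (hrP : r ≤ᶠ[𝓝 0] P)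
    (hr : r =O[𝓝 0] fun v => ‖v‖ ^ (N + 1)) (v : D) : 0 ≤ P v := by
  obtain ⟨C, hC⟩ := hr.bound
  have hv : Tendsto (fun t : ℝ => t • v) (𝓝[>] 0) (𝓝 0) := by
    have : Continuous fun t : ℝ => t • v := by fun_prop
    simpa using (this.tendsto 0).mono_left nhdsWithin_le_nhds
  have hlower : ∀ᶠ t : ℝ in 𝓝[>] 0, -(C * ‖v‖ ^ (N + 1)) * t ≤ P v := by
    filter_upwards [hv.eventually hC, hv.eventually hrP, self_mem_nhdsWithin] with t hCt hrt ht
    have ht : 0 < t := ht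
    rw [hP t ht] at hrt
    rw [norm_pow, norm_norm, norm_smul, Real.norm_of_nonneg ht.le, mul_pow] at hCt
    refine le_of_mul_le_mul_left ?_ (pow_pos ht N)
    calc t ^ N * (-(C * ‖v‖ ^ (N + 1)) * t) = -(C * (t ^ (N + 1) * ‖v‖ ^ (N + 1))) := by ring
      _ ≤ r (t • v) := neg_le_of_abs_le hCt
      _ ≤ t ^ N * P v := hrt
  have hlim : Tendsto (fun t : ℝ => -(C * ‖v‖ ^ (N + 1)) * t) (𝓝[>] 0) (𝓝 0) := by
    have : Continuous fun t : ℝ => -(C * ‖v‖ ^ (N + 1)) * t := by fun_prop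
    simpa using (this.tendsto 0).mono_left nhdsWithin_le_nhds
  exact le_of_tendsto hlim hlower

theorem eq_zero_of_homogeneous_of_isBigO {Q : D → F} {N : ℕ}
    (hQ : ∀ (t : ℝ) v, Q (t • v) = t ^ N • Q v) (hO : Q =O[𝓝 0] fun v => ‖v‖ ^ (N + 1)) :
    Q = 0 := by
  ext v
  have hnonneg := nonneg_of_homogeneous_of_isBigO_le (P := fun v => -‖Q v‖) (N := N)
    (fun t ht v => by simp [hQ, norm_smul, abs_of_pos ht]) EventuallyLE.rfl hO.norm_left.neg_left v
  simpa using hnonneg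

theorem homogeneousPart_nonneg {g : D → ℝ} {x : D} {N : ℕ} (hg : ContDiffAt ℝ (N + 1 : ℕ) g x)
    (hN : (N : ℕ∞) ≤ order g x) (hnonneg : ∀ᶠ y in 𝓝 x, 0 ≤ g y) (v : D) :
    0 ≤ homogeneousPart g x N v := by
  rw [← map_add_left_nhds_zero, eventually_map] at hnonneg
  refine nonneg_of_homogeneous_of_isBigO_le (fun t _ v => homogeneousPart_smul g x N t v) ?_
    (sub_homogeneousPart_isBigO hg hN).neg_left v
  filter_upwards [hnonneg] with v hv
  linarith

theorem le_order_iff_isBigO {g : D → F} {x : D} {N : ℕ} (hg : ContDiffAt ℝ N g x) :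
    (N : ℕ∞) ≤ order g x ↔ g =O[𝓝 x] fun y => ‖y - x‖ ^ N := by
  refine ⟨isBigO_of_le_order hg, fun hO => ?_⟩
  induction N with
  | zero => simp
  | succ N ih =>
    have hgN : ContDiffAt ℝ N g x := hg.of_le (by norm_cast; omega)
    have hpow : (fun y => ‖y - x‖ ^ (N + 1)) =O[𝓝 x] fun y => ‖y - x‖ ^ N := by
      have hbounded : (fun y => ‖y - x‖) =O[𝓝 x] fun _ => (1 : ℝ) :=
        (show ContinuousAt (fun y => ‖y - x‖) x by fun_prop).isBigO_one ℝ
      simpa [pow_succ] using (isBigO_refl (fun y => ‖y - x‖ ^ N) (𝓝 x)).mul hbounded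
    have hN : (N : ℕ∞) ≤ order g x := ih hgN (hO.trans hpow)
    rw [← map_add_left_nhds_zero, isBigO_map] at hO
    simp only [Function.comp_def, add_sub_cancel_left] at hO
    rw [succ_le_order_iff_homogeneousPart_eq_zero hgN hN]
    exact eq_zero_of_homogeneous_of_isBigO (homogeneousPart_smul g x N)
      ((hO.sub (sub_homogeneousPart_isBigO hg hN)).congr_left fun v => sub_sub_cancel _ _)

end HomogeneousPart

section Subharmonic

variable {D F : Type*} [NormedAddCommGroup D] [NormedSpace ℝ D]
  [NormedAddCommGroup F] [NormedSpace ℝ F]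

theorem fderiv_apply_self_of_homogeneous {Q : D → F} {N : ℕ}
    (hhom : ∀ (t : ℝ) v, Q (t • v) = t ^ N • Q v) {v : D} (hQ : DifferentiableAt ℝ Q v) :
    fderiv ℝ Q v v = (N : ℝ) • Q v := by
  have hradial : HasDerivAt (fun t : ℝ => t • v) v 1 := by
    simpa using (hasDerivAt_id (1 : ℝ)).smul_const v
  have hleft : HasDerivAt (fun t : ℝ => Q (t • v)) (fderiv ℝ Q v v) 1 := by
    refine HasFDerivAt.comp_hasDerivAt (1 : ℝ) ?_ hradial
    simpa using hQ.hasFDerivAt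
  have hright : HasDerivAt (fun t : ℝ => t ^ N • Q v) ((N : ℝ) • Q v) 1 := by
    simpa using (hasDerivAt_pow N (1 : ℝ)).smul_const (Q v)
  simp only [hhom] at hleft
  exact hleft.unique hright

theorem fderiv_fderiv_apply_self_of_homogeneous {Q : D → F} {N : ℕ} (hQ : ContDiff ℝ 2 Q)
    (hhom : ∀ (t : ℝ) v, Q (t • v) = t ^ N • Q v) (v : D) :
    fderiv ℝ (fderiv ℝ Q) v v v = ((N : ℝ) * (N - 1)) • Q v := by
  have hQ1 : Differentiable ℝ Q := hQ.differentiable (by simp)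
  have hQ2 : Differentiable ℝ (fderiv ℝ Q) :=
    (hQ.fderiv_right (m := 1) (by norm_num)).differentiable (by simp)
  have heuler : (fun v => fderiv ℝ Q v v) = fun v => (N : ℝ) • Q v :=
    funext fun v => fderiv_apply_self_of_homogeneous hhom (hQ1 v)
  have hderiv := congrArg (fun f => fderiv ℝ f v v) heuler
  simp only [fderiv_clm_apply (hQ2 v) differentiableAt_fun_id, fderiv_fun_const_smul (hQ1 v),
    fderiv_fun_id, _root_.add_apply, _root_.smul_apply, ContinuousLinearMap.comp_apply,
    ContinuousLinearMap.flip_apply, ContinuousLinearMap.id_apply,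
    fderiv_apply_self_of_homogeneous hhom (hQ1 v)] at hderiv
  rw [eq_sub_of_add_eq' hderiv]
  module

theorem apply_eq_apply_of_monotone_of_periodic {α β : Type*} [AddCommGroup α] [LinearOrder α]
    [IsOrderedAddMonoid α] [Archimedean α] [PartialOrder β] {f : α → β} {T : α}
    (hmono : Monotone f) (hper : Function.Periodic f T) (hT : 0 < T) (x y : α) : f x = f y := by
  wlog hxy : x ≤ y generalizing x y
  · exact (this y x (le_of_not_ge hxy)).symm
  obtain ⟨n, hn⟩ := Archimedean.arch (y - x) hT
  refine (hmono hxy).antisymm ?_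
  calc f y ≤ f (x + n • T) := hmono (sub_le_iff_le_add'.1 hn)
    _ = f x := hper.nsmul n x

theorem eq_zero_of_periodic_of_nonpos_of_le_deriv {u u' u'' : ℝ → ℝ} {T c : ℝ}
    (hu : ∀ θ, HasDerivAt u (u' θ) θ) (hu' : ∀ θ, HasDerivAt u' (u'' θ) θ)
    (hper : Function.Periodic u T) (hT : 0 < T) (hc : 0 < c) (hle : ∀ θ, u θ ≤ 0)
    (hode : ∀ θ, 0 ≤ u'' θ + c * u θ) : u = 0 := by
  have hu'per : Function.Periodic u' T := by
    intro θ
    have hshift := (hu (θ + T)).comp_add_const θ T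
    rw [hper.funext] at hshift
    exact hshift.unique (hu θ)
  have hu'mono : Monotone u' :=
    monotone_of_hasDerivAt_nonneg hu' fun θ => by
      simp only [Pi.zero_apply]
      linarith [hode θ, mul_nonpos_of_nonneg_of_nonpos hc.le (hle θ)]
  have hu'const : u' = fun _ => u' 0 :=
    funext fun θ => apply_eq_apply_of_monotone_of_periodic hu'mono hu'per hT θ 0
  ext θ
  have hu''zero : u'' θ = 0 := by
    have h := hu' θ
    rw [hu'const] at h
    exact h.unique (hasDerivAt_const _ _)
  have hnonneg := hode θ
  rw [hu''zero, zero_add] at hnonneg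
  exact (hle θ).antisymm (nonneg_of_mul_nonneg_right hnonneg hc)

theorem eq_zero_of_homogeneous_of_leviForm_nonneg {Q : ℂ → ℝ} {N : ℕ} (hQ : ContDiff ℝ 2 Q)
    (hhom : ∀ (t : ℝ) ζ, Q (t • ζ) = t ^ N • Q ζ) (hN : N ≠ 0) (hle : ∀ ζ, Q ζ ≤ 0)
    (hlevi : ∀ ζ, 0 ≤ leviForm Q ζ ζ) : Q = 0 := by
  have hQ1 : Differentiable ℝ Q := hQ.differentiable (by simp)
  have hQ2 : Differentiable ℝ (fderiv ℝ Q) :=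
    (hQ.fderiv_right (m := 1) (by norm_num)).differentiable (by simp)
  set w : ℝ → ℂ := fun θ => Complex.exp (θ * Complex.I) with hwdef
  have hw (θ : ℝ) : HasDerivAt w (Complex.I * w θ) θ := by
    have := ((hasDerivAt_id θ).ofReal_comp.mul_const Complex.I).cexp
    simpa [hwdef, mul_comm] using this
  have hu (θ : ℝ) : HasDerivAt (fun θ => Q (w θ)) (fderiv ℝ Q (w θ) (Complex.I * w θ)) θ :=
    (hQ1 (w θ)).hasFDerivAt.comp_hasDerivAt θ (hw θ)
  have hu' (θ : ℝ) : HasDerivAt (fun θ => fderiv ℝ Q (w θ) (Complex.I * w θ))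
      (fderiv ℝ (fderiv ℝ Q) (w θ) (Complex.I * w θ) (Complex.I * w θ) - N * Q (w θ)) θ := by
    have h := ((hQ2 (w θ)).hasFDerivAt.comp_hasDerivAt θ (hw θ)).clm_apply
      ((hw θ).const_mul Complex.I)
    have hIIw : Complex.I * (Complex.I * w θ) = -w θ := by
      rw [← mul_assoc, Complex.I_mul_I, neg_one_mul]
    simp only [Function.comp_apply] at h
    rwa [hIIw, map_neg, fderiv_apply_self_of_homogeneous hhom (hQ1 _), smul_eq_mul,
      ← sub_eq_add_neg] at h
  have hper : Function.Periodic (fun θ => Q (w θ)) (2 * Real.pi) := by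
    intro θ
    simp only [hwdef]
    push_cast
    rw [add_mul, Complex.exp_add, Complex.exp_two_pi_mul_I, mul_one]
  have hcircle : (fun θ => Q (w θ)) = 0 := by
    refine eq_zero_of_periodic_of_nonpos_of_le_deriv hu hu' hper Real.two_pi_pos
      (c := (N : ℝ) ^ 2) (by positivity) (fun θ => hle _) fun θ => ?_
    have hlevi := hlevi (w θ)
    have hradial := fderiv_fderiv_apply_self_of_homogeneous hQ hhom (w θ)
    rw [leviForm, hradial] at hlevi
    simp only [smul_eq_mul] at hlevi
    linarith
  ext ζ
  have hQarg : Q (Complex.exp (ζ.arg * Complex.I)) = 0 := congrFun hcircle ζ.arg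
  rw [← Complex.norm_mul_exp_arg_mul_I ζ, ← Complex.real_smul, hhom, hQarg, smul_zero,
    Pi.zero_apply]

end Subharmonic

section ZeroSet

variable {E : Type*} [NormedAddCommGroup E] [NormedSpace ℝ E] [CompleteSpace E]

theorem exists_tendsto_apply_eq_isBigO {f : E → ℝ} {f' : E →L[ℝ] ℝ} {p : E}
    (hf : HasStrictFDerivAt f f' p) (hf' : f' ≠ 0) :
    ∃ π : E → E, Tendsto π (𝓝 p) (𝓝 p) ∧ (∀ᶠ z in 𝓝 p, f (π z) = f p) ∧
      (fun z => z - π z) =O[𝓝 p] fun z => f z - f p := by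
  obtain ⟨ν, hν : f' ν = 1⟩ := LinearMap.surjective (f := f'.toLinearMap)
    (by exact_mod_cast hf') 1
  have hflow : HasStrictFDerivAt (fun x : E × ℝ => x.1 + x.2 • ν)
      (.fst ℝ E ℝ + (ContinuousLinearMap.snd ℝ E ℝ).smulRight ν) (p, 0) :=
    hasStrictFDerivAt_fst.add (hasStrictFDerivAt_snd.smul_const ν)
  have hg : HasStrictFDerivAt (fun x : E × ℝ => f (x.1 + x.2 • ν)) _ (p, 0) :=
    HasStrictFDerivAt.comp (p, 0) (g := f) (by simpa using hf) hflow
  have hinv : ((f' ∘L (.fst ℝ E ℝ + (ContinuousLinearMap.snd ℝ E ℝ).smulRight ν)) ∘L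
      .inr ℝ E ℝ).IsInvertible := by
    convert ContinuousLinearMap.isInvertible_equiv (f := ContinuousLinearEquiv.refl ℝ ℝ)
    ext
    simp [hν]
  set τ : E → ℝ := hg.implicitFunctionOfProdDomain hinv
  have hτ : Tendsto τ (𝓝 p) (𝓝 0) := hg.tendsto_implicitFunctionOfProdDomain hinv
  have hπ : Tendsto (fun z => z + τ z • ν) (𝓝 p) (𝓝 p) := by
    simpa using tendsto_id.add (hτ.smul_const ν)
  have hzero : ∀ᶠ z in 𝓝 p, f (z + τ z • ν) = f p := by
    filter_upwards [hg.eventually_apply_implicitFunctionOfProdDomain hinv] with z hz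
    rwa [zero_smul, add_zero] at hz
  have hτν : (fun z => τ z • ν) =O[𝓝 p] τ :=
    IsBigO.of_bound ‖ν‖ (.of_forall fun z => by rw [norm_smul, mul_comm])
  have hlittle : (fun z => f p - f z - τ z) =o[𝓝 p] τ := by
    have h := (hf.isLittleO.comp_tendsto (hπ.prodMk_nhds tendsto_id)).congr_right
      (g₂ := fun z => τ z • ν) fun z => by simp
    refine (h.trans_isBigO hτν).congr' (hzero.mono fun z hz => ?_) EventuallyEq.rfl
    simp [hz, hν]
  have hbig : τ =O[𝓝 p] fun z => f z - f p :=
    (hlittle.right_isBigO_add.congr_right fun z => by simp).trans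
      (isBigO_of_le _ fun z => (norm_sub_rev _ _).le)
  exact ⟨fun z => z + τ z • ν, hπ, hzero, by simpa using (hτν.trans hbig)⟩

theorem isBigO_of_eventually_zero_imp {F : Type*} [NormedAddCommGroup F] [NormedSpace ℝ F]
    {r : E → ℝ} {s : E → F} {p : E} (hr : ContDiffAt ℝ 1 r p) (hrp : r p = 0)
    (hr' : fderiv ℝ r p ≠ 0) (hs : ContDiffAt ℝ 1 s p) (hrs : ∀ᶠ z in 𝓝 p, r z = 0 → s z = 0) :
    s =O[𝓝 p] r := by
  obtain ⟨π, hπ, hrπ, hO⟩ :=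
    exists_tendsto_apply_eq_isBigO (hr.hasStrictFDerivAt (by simp)) hr'
  simp only [hrp, sub_zero] at hrπ hO
  have hsπ := (hs.hasStrictFDerivAt (by simp)).isBigO_sub.comp_tendsto (tendsto_id.prodMk_nhds hπ)
  refine (hsπ.trans hO).congr' ?_ EventuallyEq.rfl
  filter_upwards [hrπ, hπ.eventually hrs] with z hz hsz
  simp [hsz hz]

end ZeroSet

section LeviForm

theorem abs_apply_sub_apply_le {E : Type*} [NormedAddCommGroup E] [NormedSpace ℝ E]
    (B B' : E →L[ℝ] E →L[ℝ] ℝ) (v v' : E) :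
    |B v v - B' v' v'| ≤ ‖B - B'‖ * ‖v‖ ^ 2 + ‖B'‖ * ‖v - v'‖ * (‖v‖ + ‖v'‖) := by
  have hsplit : B v v - B' v' v' = (B - B') v v + B' (v - v') v + B' v' (v - v') := by
    simp only [_root_.sub_apply, map_sub]
    abel
  calc |B v v - B' v' v'| ≤ ‖(B - B') v v‖ + ‖B' (v - v') v‖ + ‖B' v' (v - v')‖ :=
      hsplit ▸ abs_add_three _ _ _
    _ ≤ ‖B - B'‖ * ‖v‖ * ‖v‖ + ‖B'‖ * ‖v - v'‖ * ‖v‖ + ‖B'‖ * ‖v'‖ * ‖v - v'‖ := by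
      gcongr <;> exact ContinuousLinearMap.le_opNorm₂ _ _ _
    _ = _ := by ring

variable {E : Type*} [NormedAddCommGroup E] [NormedSpace ℝ E] [NormedSpace ℂ E]

theorem leviForm_sub {f g : E → ℝ} {z : E} (hf : ContDiffAt ℝ 2 f z) (hg : ContDiffAt ℝ 2 g z)
    (v : E) : leviForm (fun x => f x - g x) z v = leviForm f z v - leviForm g z v := by
  have hfderiv : fderiv ℝ (fun x => f x - g x) =ᶠ[𝓝 z] fun x => fderiv ℝ f x - fderiv ℝ g x := by
    filter_upwards [hf.eventually (by simp), hg.eventually (by simp)] with x hfx hgx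
    exact fderiv_fun_sub (hfx.differentiableAt (by simp)) (hgx.differentiableAt (by simp))
  have hf' := (hf.fderiv_right (m := 1) (by norm_num)).differentiableAt (by simp)
  have hg' := (hg.fderiv_right (m := 1) (by norm_num)).differentiableAt (by simp)
  simp only [leviForm, hfderiv.fderiv_eq, fderiv_fun_sub hf' hg', _root_.sub_apply]
  ring

theorem leviForm_smul_smul_of_homogeneous {Q : E → ℝ} {N : ℕ}
    (hhom : ∀ (t : ℝ) z, Q (t • z) = t ^ N * Q z) (t : ℝ) (z v : E) :
    leviForm Q (t • z) (t • v) = t ^ N * leviForm Q z v := by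
  have hcomp : (fun z => Q (t • z)) = t ^ N • Q := funext (hhom t)
  have hfirst : (fun z => t • fderiv ℝ Q (t • z)) = t ^ N • fderiv ℝ Q := by
    rw [← fderiv_const_smul_field, ← hcomp]
    exact funext fun z => (fderiv_comp_smul t).symm
  have hsecond : t • t • fderiv ℝ (fderiv ℝ Q) (t • z) = t ^ N • fderiv ℝ (fderiv ℝ Q) z := by
    have hconst (c : ℝ) (L : E → E →L[ℝ] ℝ) :
        fderiv ℝ (fun z => c • L z) z = c • fderiv ℝ L z :=
      congrFun (fderiv_const_smul_field (f := L) c) z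
    rw [← fderiv_comp_smul, ← hconst, hfirst]
    exact hconst (t ^ N) (fderiv ℝ Q)
  have hdiag (v : E) : fderiv ℝ (fderiv ℝ Q) (t • z) (t • v) (t • v) =
      t ^ N * fderiv ℝ (fderiv ℝ Q) z v v := by
    simpa using congrArg (fun B => B v v) hsecond
  rw [leviForm, leviForm, smul_comm, hdiag, hdiag]
  ring

theorem abs_leviForm_sub_leviForm_le (f g : E → ℝ) (z z' v v' : E) :
    |leviForm f z v - leviForm g z' v'| ≤
      (‖fderiv ℝ (fderiv ℝ f) z - fderiv ℝ (fderiv ℝ g) z'‖ * ‖v‖ ^ 2 +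
        ‖fderiv ℝ (fderiv ℝ g) z'‖ * ‖v - v'‖ * (‖v‖ + ‖v'‖)) / 2 := by
  have hreal := abs_apply_sub_apply_le (fderiv ℝ (fderiv ℝ f) z) (fderiv ℝ (fderiv ℝ g) z') v v'
  have himag := abs_apply_sub_apply_le (fderiv ℝ (fderiv ℝ f) z) (fderiv ℝ (fderiv ℝ g) z')
    (Complex.I • v) (Complex.I • v')
  simp only [← smul_sub, norm_smul, Complex.norm_I, one_mul] at himag
  rw [abs_le] at hreal himag ⊢
  simp only [leviForm]
  constructor <;> linarith [hreal.1, hreal.2, himag.1, himag.2]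

theorem abs_leviForm_le (f : E → ℝ) (z v : E) :
    |leviForm f z v| ≤ ‖fderiv ℝ (fderiv ℝ f) z‖ * ‖v‖ ^ 2 / 2 := by
  have h := abs_leviForm_sub_leviForm_le f (0 : E → ℝ) z z v v
  simpa [leviForm] using h

theorem leviForm_comp [IsScalarTower ℝ ℂ E] [CompleteSpace E] {ρ : E → ℝ} {φ : ℂ → E} {ζ : ℂ}
    (hρ : ContDiffAt ℝ 2 ρ (φ ζ)) (hφ : AnalyticAt ℂ φ ζ) (w : ℂ) :
    leviForm (fun ξ => ρ (φ ξ)) ζ w = leviForm ρ (φ ζ) (w • deriv φ ζ) := by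
  have hφ' (ξ : ℂ) (hξ : AnalyticAt ℂ φ ξ) :
      HasFDerivAt φ ((ContinuousLinearMap.toSpanSingleton ℂ (deriv φ ξ)).restrictScalars ℝ) ξ :=
    hξ.differentiableAt.hasDerivAt.hasFDerivAt.restrictScalars ℝ
  have hcomp : fderiv ℝ (fun ξ => ρ (φ ξ)) =ᶠ[𝓝 ζ] fun ξ => fderiv ℝ ρ (φ ξ) ∘L
      (ContinuousLinearMap.toSpanSingleton ℂ (deriv φ ξ)).restrictScalars ℝ := by
    filter_upwards [hφ.eventually_analyticAt,
      hφ.continuousAt.eventually (hρ.eventually (by simp))] with ξ hφξ hρξ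
    exact ((hρξ.differentiableAt (by simp)).hasFDerivAt.comp ξ (hφ' ξ hφξ)).fderiv
  have hρ' : DifferentiableAt ℝ (fderiv ℝ ρ) (φ ζ) :=
    (hρ.fderiv_right (m := 1) (by norm_num)).differentiableAt (by simp)
  have hρφ : ContDiffAt ℝ 2 (fun ξ => ρ (φ ξ)) ζ :=
    ContDiffAt.comp ζ (g := ρ) hρ (hφ.contDiffAt.restrict_scalars ℝ)
  have hρφ' : DifferentiableAt ℝ (fderiv ℝ fun ξ => ρ (φ ξ)) ζ :=
    (hρφ.fderiv_right (m := 1) (by norm_num)).differentiableAt (by simp)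
  have hsecond (w : ℂ) : fderiv ℝ (fderiv ℝ fun ξ => ρ (φ ξ)) ζ w w =
      fderiv ℝ (fderiv ℝ ρ) (φ ζ) (w • deriv φ ζ) (w • deriv φ ζ) +
        fderiv ℝ ρ (φ ζ) (w ^ 2 • deriv (deriv φ) ζ) := by
    have hleft : HasFDerivAt (fun ξ => fderiv ℝ (fun ξ => ρ (φ ξ)) ξ w)
        ((fderiv ℝ (fderiv ℝ fun ξ => ρ (φ ξ)) ζ).flip w) ζ := by
      simpa using hρφ'.hasFDerivAt.clm_apply (hasFDerivAt_const w ζ)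
    have hright : HasFDerivAt (fun ξ => fderiv ℝ ρ (φ ξ) (w • deriv φ ξ)) _ ζ :=
      (hρ'.hasFDerivAt.comp ζ (hφ' ζ hφ)).clm_apply
        ((hφ.deriv.differentiableAt.hasDerivAt.hasFDerivAt.restrictScalars ℝ).const_smul w)
    have heq : (fun ξ => fderiv ℝ (fun ξ => ρ (φ ξ)) ξ w) =ᶠ[𝓝 ζ]
        fun ξ => fderiv ℝ ρ (φ ξ) (w • deriv φ ξ) :=
      hcomp.mono fun ξ hξ => congrArg (fun L => L w) hξ
    have hw := congrArg (fun L => L w) (hleft.unique (hright.congr_of_eventuallyEq heq))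
    refine hw.trans ?_
    simp [add_comm, smul_smul, sq]
  -- The contributions of the second derivative of `φ` cancel because `(i w) ^ 2 = -w ^ 2`.
  have hcancel : (Complex.I • w) ^ 2 • deriv (deriv φ) ζ = -(w ^ 2 • deriv (deriv φ) ζ) := by
    rw [smul_pow, Complex.I_sq, neg_one_smul, neg_smul]
  rw [leviForm, leviForm, hsecond, hsecond, hcancel, map_neg, smul_assoc Complex.I w]
  ring

end LeviForm

section Pseudoconvex

variable {E : Type*} [NormedAddCommGroup E] [NormedSpace ℝ E] [NormedSpace ℂ E]
  [IsScalarTower ℝ ℂ E]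

/-- The holomorphic differential `v ↦ 2 ∑ j, (∂ ρ / ∂ z_j) (z) v_j` of `ρ` at `z`, encoded as the
complex-linear functional whose real part is the real differential of `ρ`. -/
def holoFDeriv (ρ : E → ℝ) (z : E) : E →L[ℂ] ℂ :=
  StrongDual.extendRCLikeₗᵢ (fderiv ℝ ρ z)

theorem holoFDeriv_apply (ρ : E → ℝ) (z v : E) :
    holoFDeriv ρ z v = fderiv ℝ ρ z v - Complex.I * fderiv ℝ ρ z (Complex.I • v) :=
  StrongDual.extendRCLike_apply (𝕜 := ℂ) _ _

theorem norm_holoFDeriv (ρ : E → ℝ) (z : E) : ‖holoFDeriv ρ z‖ = ‖fderiv ℝ ρ z‖ :=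
  LinearIsometryEquiv.norm_map _ _

theorem norm_holoFDeriv_sub (ρ : E → ℝ) (z z' : E) :
    ‖holoFDeriv ρ z - holoFDeriv ρ z'‖ = ‖fderiv ℝ ρ z - fderiv ℝ ρ z'‖ := by
  rw [holoFDeriv, holoFDeriv, ← map_sub, LinearIsometryEquiv.norm_map]

theorem isComplexTangent_iff {ρ : E → ℝ} {z v : E} :
    IsComplexTangent ρ z v ↔ holoFDeriv ρ z v = 0 := by
  simp [holoFDeriv_apply, IsComplexTangent, Complex.ext_iff]

theorem holoFDeriv_comp {ρ : E → ℝ} {φ : ℂ → E} {ζ : ℂ} (hρ : DifferentiableAt ℝ ρ (φ ζ))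
    (hφ : DifferentiableAt ℂ φ ζ) (w : ℂ) :
    holoFDeriv (fun ξ => ρ (φ ξ)) ζ w = holoFDeriv ρ (φ ζ) (w • deriv φ ζ) := by
  have hfderiv := (hρ.hasFDerivAt.comp ζ (hφ.hasDerivAt.hasFDerivAt.restrictScalars ℝ)).fderiv
  simp only [Function.comp_def] at hfderiv
  have happly (w : ℂ) : fderiv ℝ (fun ξ => ρ (φ ξ)) ζ w = fderiv ℝ ρ (φ ζ) (w • deriv φ ζ) := by
    rw [hfderiv]
    rfl
  rw [holoFDeriv_apply, holoFDeriv_apply, happly, happly, smul_assoc]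

theorem neg_le_leviForm_of_isComplexTangent {ρ : E → ℝ} {z ν : E} (hν : holoFDeriv ρ z ν ≠ 0)
    (hlevi : ∀ v, IsComplexTangent ρ z v → 0 ≤ leviForm ρ z v) (v : E) :
    -(‖fderiv ℝ (fderiv ℝ ρ) z‖ * (‖ν‖ / ‖holoFDeriv ρ z ν‖) *
        (2 + ‖ν‖ / ‖holoFDeriv ρ z ν‖ * ‖holoFDeriv ρ z‖) / 2 * ‖holoFDeriv ρ z v‖ * ‖v‖) ≤
      leviForm ρ z v := by
  set P := holoFDeriv ρ z with hP
  set κ := ‖ν‖ / ‖P ν‖ with hκ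
  set v' := v - (P v / P ν) • ν with hv'
  have hsub : ‖v - v'‖ = κ * ‖P v‖ := by
    rw [hv', sub_sub_cancel, norm_smul, norm_div, hκ]
    ring
  have hnorm : ‖v'‖ ≤ ‖v‖ + κ * (‖P‖ * ‖v‖) := by
    calc ‖v'‖ ≤ ‖v‖ + ‖v - v'‖ := norm_le_norm_add_norm_sub v v'
      _ ≤ ‖v‖ + κ * (‖P‖ * ‖v‖) := by
        rw [hsub]
        gcongr
        exact P.le_opNorm v
  have htangent : 0 ≤ leviForm ρ z v' := by
    refine hlevi v' (isComplexTangent_iff.2 ?_)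
    rw [← hP, hv', map_sub, map_smul, smul_eq_mul, div_mul_cancel₀ _ hν, sub_self]
  have hdiff := abs_leviForm_sub_leviForm_le ρ ρ z z v v'
  rw [sub_self, norm_zero (E := E →L[ℝ] E →L[ℝ] ℝ), zero_mul, zero_add, hsub] at hdiff
  have hbound : ‖fderiv ℝ (fderiv ℝ ρ) z‖ * (κ * ‖P v‖) * (‖v‖ + ‖v'‖) / 2 ≤
      ‖fderiv ℝ (fderiv ℝ ρ) z‖ * (κ * ‖P v‖) * (‖v‖ + (‖v‖ + κ * (‖P‖ * ‖v‖))) / 2 := by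
    gcongr
  have := neg_abs_le (leviForm ρ z v - leviForm ρ z v')
  linear_combination this + hdiff + hbound + htangent

theorem exists_eventually_neg_le_leviForm_of_isComplexTangent {ρ : E → ℝ} {z₀ : E}
    (hρ : ContDiffAt ℝ 2 ρ z₀) (hρ' : fderiv ℝ ρ z₀ ≠ 0) :
    ∃ C ≥ 0, ∀ᶠ z in 𝓝 z₀, (∀ v, IsComplexTangent ρ z v → 0 ≤ leviForm ρ z v) →
      ∀ v, -(C * ‖holoFDeriv ρ z v‖ * ‖v‖) ≤ leviForm ρ z v := by
  obtain ⟨ν, hν⟩ : ∃ ν, holoFDeriv ρ z₀ ν ≠ 0 :=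
    DFunLike.ne_iff.1 ((map_ne_zero_iff _ (LinearIsometryEquiv.injective _)).2 hρ')
  have hD : ContDiffAt ℝ 1 (fderiv ℝ ρ) z₀ := hρ.fderiv_right (by norm_num)
  have hcont : ContinuousAt (holoFDeriv ρ) z₀ :=
    (LinearIsometryEquiv.continuous _).continuousAt.comp hD.continuousAt
  have hνcont : ContinuousAt (fun z => holoFDeriv ρ z ν) z₀ := hcont.clm_apply continuousAt_const
  set K : E → ℝ := fun z => ‖fderiv ℝ (fderiv ℝ ρ) z‖ * (‖ν‖ / ‖holoFDeriv ρ z ν‖) *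
    (2 + ‖ν‖ / ‖holoFDeriv ρ z ν‖ * ‖holoFDeriv ρ z‖) / 2
  have hK : ContinuousAt K z₀ := by
    have hD2 : ContinuousAt (fun z => ‖fderiv ℝ (fderiv ℝ ρ) z‖) z₀ :=
      continuous_norm.continuousAt.comp (hD.fderiv_right (m := 0) le_rfl).continuousAt
    have hκ : ContinuousAt (fun z => ‖ν‖ / ‖holoFDeriv ρ z ν‖) z₀ :=
      continuousAt_const.div hνcont.norm (norm_ne_zero_iff.2 hν)
    exact ((hD2.mul hκ).mul (continuousAt_const.add (hκ.mul hcont.norm))).div_const 2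
  refine ⟨K z₀ + 1, by positivity, ?_⟩
  filter_upwards [hK.eventually_lt_const (lt_add_one _), hνcont.eventually_ne hν]
    with z hKz hνz hlevi v
  calc -((K z₀ + 1) * ‖holoFDeriv ρ z v‖ * ‖v‖) ≤ -(K z * ‖holoFDeriv ρ z v‖ * ‖v‖) := by gcongr
    _ ≤ leviForm ρ z v := neg_le_leviForm_of_isComplexTangent hνz hlevi v

theorem exists_eventually_neg_le_leviForm [CompleteSpace E] {ρ : E → ℝ} {z₀ : E}
    (hρ : ContDiffAt ℝ 3 ρ z₀) (hρ₀ : ρ z₀ = 0) (hρ' : fderiv ℝ ρ z₀ ≠ 0)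
    (hlevi : ∀ᶠ z in 𝓝 z₀, ρ z = 0 → ∀ v, IsComplexTangent ρ z v → 0 ≤ leviForm ρ z v) :
    ∃ C, ∀ᶠ z in 𝓝 z₀, ∀ v,
      -(C * ((|ρ z| * ‖v‖ + ‖holoFDeriv ρ z v‖) * ‖v‖)) ≤ leviForm ρ z v := by
  have hD1 : ContDiffAt ℝ 2 (fderiv ℝ ρ) z₀ := hρ.fderiv_right (by norm_num)
  have hD2 : ContDiffAt ℝ 1 (fderiv ℝ (fderiv ℝ ρ)) z₀ := hD1.fderiv_right (by norm_num)
  obtain ⟨π, hπ, hρπ, hsub⟩ := exists_tendsto_apply_eq_isBigO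
    (hρ.hasStrictFDerivAt (by simp)) hρ'
  simp only [hρ₀, sub_zero] at hρπ hsub
  have hdisp {G : Type _} [NormedAddCommGroup G] [NormedSpace ℝ G] {s : E → G}
      (hs : ContDiffAt ℝ 1 s z₀) : (fun z => s z - s (π z)) =O[𝓝 z₀] ρ :=
    ((hs.hasStrictFDerivAt (by simp)).isBigO_sub.comp_tendsto
      (tendsto_id.prodMk_nhds hπ)).trans hsub
  obtain ⟨A, hA₀, hA⟩ := (hdisp hD2).exists_nonneg
  obtain ⟨B, hB₀, hB⟩ := (hdisp (hD1.of_le (by norm_num))).exists_nonneg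
  obtain ⟨K, hK₀, hK⟩ := exists_eventually_neg_le_leviForm_of_isComplexTangent
    (hρ.of_le (by norm_num)) hρ'
  refine ⟨K * (1 + B) + A, ?_⟩
  filter_upwards [hA.bound, hB.bound, hρπ, hπ.eventually (hlevi.and hK)]
    with z hAz hBz hρπz ⟨hleviπ, hKπ⟩ v
  have hholo : ‖holoFDeriv ρ (π z) v‖ ≤ ‖holoFDeriv ρ z v‖ + B * |ρ z| * ‖v‖ := by
    calc ‖holoFDeriv ρ (π z) v‖
        ≤ ‖holoFDeriv ρ z v‖ + ‖(holoFDeriv ρ z - holoFDeriv ρ (π z)) v‖ :=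
          norm_le_norm_add_norm_sub _ _
      _ ≤ ‖holoFDeriv ρ z v‖ + B * |ρ z| * ‖v‖ := by
        gcongr
        refine ContinuousLinearMap.le_of_opNorm_le _ ?_ v
        rwa [norm_holoFDeriv_sub]
  have hlower : -(K * (‖holoFDeriv ρ z v‖ + B * |ρ z| * ‖v‖) * ‖v‖) ≤ leviForm ρ (π z) v := by
    refine le_trans ?_ (hKπ (hleviπ hρπz) v)
    gcongr
  have hmove : |leviForm ρ z v - leviForm ρ (π z) v| ≤ A * |ρ z| * ‖v‖ ^ 2 / 2 := by
    have h := abs_leviForm_sub_leviForm_le ρ ρ z (π z) v v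
    rw [sub_self, norm_zero, mul_zero, zero_mul, add_zero] at h
    refine h.trans ?_
    gcongr
    exact hAz
  have hsub_le := neg_abs_le (leviForm ρ z v - leviForm ρ (π z) v)
  have hslack : 0 ≤ K * (|ρ z| * ‖v‖ + B * ‖holoFDeriv ρ z v‖) * ‖v‖ +
    A * (|ρ z| * ‖v‖ / 2 + ‖holoFDeriv ρ z v‖) * ‖v‖ := by positivity
  linear_combination hsub_le + hmove + hlower + hslack

end Pseudoconvex

section LeviFormAlongDisc

theorem fderiv_isBigO_of_le_order {D F : Type*} [NormedAddCommGroup D] [NormedSpace ℝ D]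
    [NormedAddCommGroup F] [NormedSpace ℝ F] {g : D → F} {x : D} {k : ℕ}
    (hg : ContDiffAt ℝ (k + 1 : ℕ) g x) (hk : ((k + 1 : ℕ) : ℕ∞) ≤ order g x) :
    (fun y => ‖fderiv ℝ g y‖) =O[𝓝 x] fun y => ‖y - x‖ ^ k := by
  have hO := (iteratedFDeriv_isBigO_of_le_order hg hk (add_comm 1 k)).norm_left
  simpa only [← norm_iteratedFDeriv_fderiv, norm_iteratedFDeriv_zero] using hO

variable {E : Type*} [NormedAddCommGroup E] [NormedSpace ℝ E] [NormedSpace ℂ E]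

theorem leviForm_self_isBigO_of_le_order {g : E → ℝ} {k : ℕ}
    (hg : ContDiffAt ℝ (k + 2 : ℕ) g 0) (hk : ((k + 2 : ℕ) : ℕ∞) ≤ order g 0) :
    (fun v => leviForm g v v) =O[𝓝 0] fun v => ‖v‖ ^ (k + 2) := by
  have hO := (iteratedFDeriv_isBigO_of_le_order hg hk (add_comm 2 k)).norm_left
  simp only [← norm_iteratedFDeriv_fderiv, norm_iteratedFDeriv_zero, sub_zero] at hO
  have hbound : (fun v => leviForm g v v) =O[𝓝 0] fun v =>
      ‖fderiv ℝ (fderiv ℝ g) v‖ * ‖v‖ ^ 2 := by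
    refine IsBigO.of_bound (1 / 2) (.of_forall fun v => (abs_leviForm_le g v v).trans ?_)
    rw [Real.norm_of_nonneg (by positivity)]
    linarith
  simpa only [pow_add] using hbound.trans (hO.mul (isBigO_refl _ _))

theorem leviForm_self_sub_leviForm_homogeneousPart_isBigO {g : E → ℝ} {k : ℕ}
    (hg : ContDiffAt ℝ (k + 2 : ℕ) g 0) (hk : ((k + 1 : ℕ) : ℕ∞) ≤ order g 0) :
    (fun v => leviForm g v v - leviForm (homogeneousPart g 0 (k + 1)) v v) =O[𝓝 0]
      fun v => ‖v‖ ^ (k + 2) := by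
  have horder := succ_le_order_sub_homogeneousPart (hg.of_le (by norm_cast; omega)) hk
  simp only [sub_zero] at horder
  have hQ {n : ℕ∞ω} : ContDiff ℝ n (homogeneousPart g 0 (k + 1)) := contDiff_homogeneousPart g 0 _
  refine (leviForm_self_isBigO_of_le_order (hg.sub hQ.contDiffAt) horder).congr' ?_ .rfl
  have hg2 : ContDiffAt ℝ 2 g 0 := hg.of_le (by norm_cast; omega)
  filter_upwards [hg2.eventually (by simp)] with v hv
  exact leviForm_sub hv hQ.contDiffAt v

variable [IsScalarTower ℝ ℂ E] [CompleteSpace E]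

theorem exists_isBigO_eventually_le_leviForm_comp {ρ : E → ℝ} {φ : ℂ → E} {k : ℕ}
    (hφ : AnalyticAt ℂ φ 0) (hρ : ContDiffAt ℝ ∞ ρ (φ 0)) (hρ₀ : ρ (φ 0) = 0)
    (hρ' : fderiv ℝ ρ (φ 0) ≠ 0)
    (hlevi : ∀ᶠ z in 𝓝 (φ 0), ρ z = 0 → ∀ v, IsComplexTangent ρ z v → 0 ≤ leviForm ρ z v)
    (hk : ((k + 1 : ℕ) : ℕ∞) ≤ order (fun ζ => ρ (φ ζ)) 0) :
    ∃ r : ℂ → ℝ, r =O[𝓝 0] (fun ζ => ‖ζ‖ ^ (k + 2)) ∧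
      r ≤ᶠ[𝓝 0] fun ζ => leviForm (fun ξ => ρ (φ ξ)) ζ ζ := by
  set f : ℂ → ℝ := fun ζ => ρ (φ ζ)
  have hf : ContDiffAt ℝ (k + 1 : ℕ) f 0 :=
    contDiffAt_infty.1 (ContDiffAt.comp 0 (g := ρ) hρ (hφ.contDiffAt.restrict_scalars ℝ)) _
  obtain ⟨C, hC⟩ := exists_eventually_neg_le_leviForm (contDiffAt_infty.1 hρ 3) hρ₀ hρ' hlevi
  refine ⟨fun ζ => -(C * ((|f ζ| * ‖ζ • deriv φ ζ‖ + ‖holoFDeriv f ζ ζ‖) * ‖ζ • deriv φ ζ‖)),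
    ?_, ?_⟩
  · have hv : (fun ζ => ‖ζ • deriv φ ζ‖) =O[𝓝 0] fun ζ => ‖ζ‖ := by
      simpa using ((isBigO_refl (fun ζ : ℂ => ζ) (𝓝 0)).smul
        (hφ.deriv.continuousAt.isBigO_one ℂ)).norm_norm
    have hfO : (fun ζ => |f ζ|) =O[𝓝 0] fun ζ => ‖ζ‖ ^ (k + 1) := by
      simpa using (isBigO_of_le_order hf hk).abs_left
    have hholo : (fun ζ => ‖holoFDeriv f ζ ζ‖) =O[𝓝 0] fun ζ => ‖ζ‖ ^ (k + 1) := by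
      have hle : (fun ζ => ‖holoFDeriv f ζ ζ‖) =O[𝓝 0] fun ζ => ‖fderiv ℝ f ζ‖ * ‖ζ‖ :=
        IsBigO.of_bound 1 (.of_forall fun ζ => by
          simpa [norm_holoFDeriv] using (holoFDeriv f ζ).le_opNorm ζ)
      simpa [pow_succ] using
        hle.trans ((fderiv_isBigO_of_le_order hf hk).mul (isBigO_refl (fun ζ : ℂ => ‖ζ‖) _))
    have hv_one : (fun ζ => ‖ζ • deriv φ ζ‖) =O[𝓝 0] fun _ => (1 : ℝ) :=
      (continuousAt_id.smul hφ.deriv.continuousAt).norm.isBigO_one ℝ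
    have hsum := (((hfO.mul hv_one).congr_right fun ζ => mul_one _).add hholo).mul hv
    simpa [pow_succ, mul_assoc] using (hsum.const_mul_left C).neg_left
  · filter_upwards [hφ.continuousAt.eventually (hC.and ((contDiffAt_infty.1 hρ 2).eventually
      (by simp))), hφ.eventually_analyticAt] with ζ ⟨hCζ, hρζ⟩ hφζ
    rw [leviForm_comp hρζ hφζ, holoFDeriv_comp (hρζ.differentiableAt (by simp))
      hφζ.differentiableAt]
    exact hCζ _

theorem leviForm_homogeneousPart_comp_nonneg {ρ : E → ℝ} {φ : ℂ → E} {k : ℕ}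
    (hφ : AnalyticAt ℂ φ 0) (hρ : ContDiffAt ℝ ∞ ρ (φ 0)) (hρ₀ : ρ (φ 0) = 0)
    (hρ' : fderiv ℝ ρ (φ 0) ≠ 0)
    (hlevi : ∀ᶠ z in 𝓝 (φ 0), ρ z = 0 → ∀ v, IsComplexTangent ρ z v → 0 ≤ leviForm ρ z v)
    (hk : ((k + 1 : ℕ) : ℕ∞) ≤ order (fun ζ => ρ (φ ζ)) 0) (ζ : ℂ) :
    0 ≤ leviForm (homogeneousPart (fun ξ => ρ (φ ξ)) 0 (k + 1)) ζ ζ := by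
  obtain ⟨r, hrO, hr⟩ := exists_isBigO_eventually_le_leviForm_comp hφ hρ hρ₀ hρ' hlevi hk
  have hf : ContDiffAt ℝ (k + 2 : ℕ) (fun ζ => ρ (φ ζ)) 0 :=
    contDiffAt_infty.1 (ContDiffAt.comp 0 (g := ρ) hρ (hφ.contDiffAt.restrict_scalars ℝ)) _
  refine nonneg_of_homogeneous_of_isBigO_le (N := k + 1)
    (P := fun ζ => leviForm (homogeneousPart (fun ξ => ρ (φ ξ)) 0 (k + 1)) ζ ζ)
    (fun t _ ζ => leviForm_smul_smul_of_homogeneous (homogeneousPart_smul _ _ _) t ζ ζ) ?_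
    (hrO.sub (leviForm_self_sub_leviForm_homogeneousPart_isBigO hf hk)) ζ
  filter_upwards [hr] with ζ hζ
  linarith

end LeviFormAlongDisc

section OrderOfSum

theorem order_add_le_min_of_leviForm_homogeneousPart_nonneg {f g : ℂ → ℝ}
    (hf : ContDiffAt ℝ ∞ f 0) (hf₀ : f 0 = 0) (hg : ContDiffAt ℝ ∞ g 0)
    (hnonneg : ∀ᶠ ζ in 𝓝 0, 0 ≤ g ζ)
    (hlevi : ∀ k : ℕ, ((k + 1 : ℕ) : ℕ∞) ≤ order f 0 →
      ∀ ζ, 0 ≤ leviForm (homogeneousPart f 0 (k + 1)) ζ ζ) :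
    order (fun ζ => f ζ + g ζ) 0 ≤ min (order f 0) (order g 0) := by
  refine ENat.forall_natCast_le_iff_le.1 fun N => ?_
  induction N with
  | zero => simp
  | succ N ih =>
    intro hN
    have hNle : (N : ℕ∞) ≤ order (fun ζ => f ζ + g ζ) 0 := le_trans (by norm_cast; omega) hN
    obtain ⟨hfN, hgN⟩ := le_min_iff.1 (ih hNle)
    have hf' := contDiffAt_infty.1 hf N
    have hg' := contDiffAt_infty.1 hg N
    have hsum (ζ : ℂ) : homogeneousPart f 0 N ζ + homogeneousPart g 0 N ζ = 0 := by
      rw [← homogeneousPart_add hf' hg',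
        (succ_le_order_iff_homogeneousPart_eq_zero (hf'.add hg') hNle).1 hN, Pi.zero_apply]
    have hg_nonneg := homogeneousPart_nonneg (contDiffAt_infty.1 hg (N + 1)) hgN hnonneg
    have hfpart : homogeneousPart f 0 N = 0 := by
      cases N with
      | zero =>
        ext ζ
        simp [homogeneousPart, hf₀]
      | succ k =>
        exact eq_zero_of_homogeneous_of_leviForm_nonneg (contDiff_homogeneousPart f 0 _)
          (homogeneousPart_smul f 0 _) k.succ_ne_zero
          (fun ζ => by linarith [hsum ζ, hg_nonneg ζ]) (hlevi k hfN)
    have hgpart : homogeneousPart g 0 N = 0 := by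
      ext ζ
      simpa [hfpart] using hsum ζ
    exact le_min ((succ_le_order_iff_homogeneousPart_eq_zero hf' hfN).2 hfpart)
      ((succ_le_order_iff_homogeneousPart_eq_zero hg' hgN).2 hgpart)

theorem order_comp_le_order_comp_of_eventually_zero_imp {D E F : Type*} [NormedAddCommGroup D]
    [NormedSpace ℝ D] [NormedAddCommGroup E] [NormedSpace ℝ E] [CompleteSpace E]
    [NormedAddCommGroup F] [NormedSpace ℝ F] {φ : D → E} {x : D} {r : E → ℝ} {s : E → F}
    (hφ : ContDiffAt ℝ ∞ φ x) (hr : ContDiffAt ℝ ∞ r (φ x)) (hr₀ : r (φ x) = 0)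
    (hr' : fderiv ℝ r (φ x) ≠ 0) (hs : ContDiffAt ℝ ∞ s (φ x))
    (hrs : ∀ᶠ z in 𝓝 (φ x), r z = 0 → s z = 0) :
    order (fun y => r (φ y)) x ≤ order (fun y => s (φ y)) x := by
  have hO : s =O[𝓝 (φ x)] r :=
    isBigO_of_eventually_zero_imp (contDiffAt_infty.1 hr 1) hr₀ hr' (contDiffAt_infty.1 hs 1) hrs
  refine ENat.forall_natCast_le_iff_le.1 fun N hN => ?_
  have hrφ : ContDiffAt ℝ N (fun y => r (φ y)) x :=
    contDiffAt_infty.1 (ContDiffAt.comp x (g := r) hr hφ) N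
  have hsφ : ContDiffAt ℝ N (fun y => s (φ y)) x :=
    contDiffAt_infty.1 (ContDiffAt.comp x (g := s) hs hφ) N
  rw [le_order_iff_isBigO hrφ] at hN
  rw [le_order_iff_isBigO hsφ]
  exact (hO.comp_tendsto hφ.continuousAt).trans hN

end OrderOfSum

section TypeOfFunction

theorem IsDisc.analyticAt {E : Type*} [NormedAddCommGroup E] [NormedSpace ℂ E] [CompleteSpace E]
    {φ : ℂ → E} (hφ : IsDisc φ) : AnalyticAt ℂ φ 0 :=
  hφ.holomorphic.analyticAt (Metric.ball_mem_nhds 0 one_pos)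

variable {E F : Type*} [NormedAddCommGroup E] [NormedSpace ℝ E] [NormedSpace ℂ E]
  [NormedAddCommGroup F] [NormedSpace ℝ F] [NormedSpace ℂ F]

theorem div_order_le_typeAt (k : E → ℝ) (p : E) {φ : ℂ → E}
    (hφ : DifferentiableOn ℂ φ (Metric.ball 0 1)) (hφ₀ : φ 0 = 0) :
    (order (fun ζ => k (p + φ ζ)) 0 : ℝ≥0∞) / (order φ 0 : ℝ≥0∞) ≤ typeAt k p := by
  by_cases hne : ∃ ζ ∈ Metric.ball (0 : ℂ) 1, φ ζ ≠ 0
  · exact le_iSup₂_of_le (f := fun (φ : ℂ → E) (_ : IsDisc φ) =>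
      (order (fun ζ => k (p + φ ζ)) 0 : ℝ≥0∞) / (order φ 0 : ℝ≥0∞)) φ ⟨hφ, hφ₀, hne⟩ le_rfl
  · have hzero : φ =ᶠ[𝓝 0] fun _ => 0 := by
      filter_upwards [Metric.ball_mem_nhds (0 : ℂ) one_pos] with ζ hζ
      exact by_contra fun h => hne ⟨ζ, hζ, h⟩
    simp [order_congr hzero, order_fun_zero]

variable [IsScalarTower ℝ ℂ E] [CompleteSpace E]

theorem IsDisc.contDiffAt {φ : ℂ → E} (hφ : IsDisc φ) : ContDiffAt ℝ ∞ φ 0 :=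
  hφ.analyticAt.contDiffAt.restrict_scalars ℝ

theorem typeAt_mk_left_le (k : E × F → ℝ) (z : E) (w : F) :
    typeAt (fun z => k (z, w)) z ≤ typeAt k (z, w) := by
  refine iSup₂_le fun ψ hψ => ?_
  have hle := div_order_le_typeAt k (z, w) (φ := fun ζ => (ψ ζ, 0))
    (hψ.holomorphic.prodMk (differentiableOn_const 0)) (by simp [hψ.map_zero])
  rw [order_prodMk hψ.contDiffAt contDiffAt_const, order_fun_zero, min_top_right] at hle
  simpa using hle

theorem typeAt_mk_right_le (k : F × E → ℝ) (z : F) (w : E) :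
    typeAt (fun w => k (z, w)) w ≤ typeAt k (z, w) := by
  refine iSup₂_le fun χ hχ => ?_
  have hle := div_order_le_typeAt k (z, w) (φ := fun ζ => (0, χ ζ))
    ((differentiableOn_const 0).prodMk hχ.holomorphic) (by simp [hχ.map_zero])
  rw [order_prodMk contDiffAt_const hχ.contDiffAt, order_fun_zero, min_top_left] at hle
  simpa using hle

theorem typeAt_le_typeAt_of_eventually_zero_imp {r s : E → ℝ} {p : E} (hr : ContDiffAt ℝ ∞ r p)
    (hr₀ : r p = 0) (hr' : fderiv ℝ r p ≠ 0) (hs : ContDiffAt ℝ ∞ s p)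
    (hrs : ∀ᶠ z in 𝓝 p, r z = 0 → s z = 0) : typeAt r p ≤ typeAt s p := by
  refine iSup₂_mono fun φ hφ => ENNReal.div_le_div_right (mod_cast ?_) _
  have hp : p + φ 0 = p := by rw [hφ.map_zero, add_zero]
  exact order_comp_le_order_comp_of_eventually_zero_imp (φ := fun ζ => p + φ ζ)
    (contDiffAt_const.add hφ.contDiffAt) (by rwa [hp]) (by rwa [hp]) (by rwa [hp]) (by rwa [hp])
    (by rwa [hp])

theorem IsLocalDefiningFunction.typeAt_le {M : Set E} {p : E} {r s : E → ℝ}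
    (hr : IsLocalDefiningFunction M p r) (hs : IsLocalDefiningFunction M p s) :
    typeAt r p ≤ typeAt s p := by
  obtain ⟨hp, W, hW, hpW, hrW, hr', hrM⟩ := hr
  obtain ⟨-, W', hW', hpW', hsW', -, hsM⟩ := hs
  refine typeAt_le_typeAt_of_eventually_zero_imp (hrW.contDiffAt (hW.mem_nhds hpW))
    ((hrM p hpW).1 hp) (hr' p hpW) (hsW'.contDiffAt (hW'.mem_nhds hpW')) ?_
  filter_upwards [hW.mem_nhds hpW, hW'.mem_nhds hpW'] with z hz hz'
  rw [← hrM z hz, hsM z hz']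
  exact id

theorem IsLocalDefiningFunction.typeAt_eq {M : Set E} {p : E} {r s : E → ℝ}
    (hr : IsLocalDefiningFunction M p r) (hs : IsLocalDefiningFunction M p s) :
    typeAt r p = typeAt s p :=
  le_antisymm (hr.typeAt_le hs) (hs.typeAt_le hr)

variable [IsScalarTower ℝ ℂ F] [CompleteSpace F]

theorem order_comp_add_comp_le_min {ρ : E → ℝ} {h : F → ℝ} {ψ : ℂ → E} {χ : ℂ → F}
    (hψ : AnalyticAt ℂ ψ 0) (hχ : AnalyticAt ℂ χ 0) (hρ : ContDiffAt ℝ ∞ ρ (ψ 0))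
    (hρ₀ : ρ (ψ 0) = 0) (hρ' : fderiv ℝ ρ (ψ 0) ≠ 0)
    (hlevi : ∀ᶠ z in 𝓝 (ψ 0), ρ z = 0 → ∀ v, IsComplexTangent ρ z v → 0 ≤ leviForm ρ z v)
    (hh : ContDiffAt ℝ ∞ h (χ 0)) (hnonneg : ∀ᶠ w in 𝓝 (χ 0), 0 ≤ h w) :
    order (fun ζ => ρ (ψ ζ) + h (χ ζ)) 0 ≤
      min (order (fun ζ => ρ (ψ ζ)) 0) (order (fun ζ => h (χ ζ)) 0) :=
  order_add_le_min_of_leviForm_homogeneousPart_nonneg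
    (ContDiffAt.comp 0 (g := ρ) hρ (hψ.contDiffAt.restrict_scalars ℝ)) hρ₀
    (ContDiffAt.comp 0 (g := h) hh (hχ.contDiffAt.restrict_scalars ℝ))
    (hχ.continuousAt.eventually hnonneg)
    fun _ hk => leviForm_homogeneousPart_comp_nonneg hψ hρ hρ₀ hρ' hlevi hk

theorem typeAt_add {ρ : E → ℝ} {h : F → ℝ} {z₀ : E} {w₀ : F} (hρ : ContDiffAt ℝ ∞ ρ z₀)
    (hρ₀ : ρ z₀ = 0) (hρ' : fderiv ℝ ρ z₀ ≠ 0)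
    (hlevi : ∀ᶠ z in 𝓝 z₀, ρ z = 0 → ∀ v, IsComplexTangent ρ z v → 0 ≤ leviForm ρ z v)
    (hh : ContDiffAt ℝ ∞ h w₀) (hh₀ : h w₀ = 0) (hnonneg : ∀ᶠ w in 𝓝 w₀, 0 ≤ h w) :
    typeAt (fun p : E × F => ρ p.1 + h p.2) (z₀, w₀) = max (typeAt ρ z₀) (typeAt h w₀) := by
  refine le_antisymm (iSup₂_le fun φ hφ => ?_) (max_le ?_ ?_)
  · have hfst : AnalyticAt ℂ (fun ζ => (φ ζ).1) 0 := analyticAt_fst.comp hφ.analyticAt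
    have hsnd : AnalyticAt ℂ (fun ζ => (φ ζ).2) 0 := analyticAt_snd.comp hφ.analyticAt
    have hz₀ : z₀ + (φ 0).1 = z₀ := by simp [hφ.map_zero]
    have hw₀ : w₀ + (φ 0).2 = w₀ := by simp [hφ.map_zero]
    have horder : order φ 0 = min (order (fun ζ => (φ ζ).1) 0) (order (fun ζ => (φ ζ).2) 0) :=
      order_prodMk hφ.contDiffAt.fst hφ.contDiffAt.snd
    have hle := order_comp_add_comp_le_min (ψ := fun ζ => z₀ + (φ ζ).1)
      (χ := fun ζ => w₀ + (φ ζ).2) (analyticAt_const.add hfst) (analyticAt_const.add hsnd)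
      (by rwa [hz₀]) (by rwa [hz₀]) (by rwa [hz₀]) (by rwa [hz₀]) (by rwa [hw₀]) (by rwa [hw₀])
    obtain ⟨hleρ, hleh⟩ := le_min_iff.1 hle
    rcases min_choice (order (fun ζ => (φ ζ).1) 0) (order (fun ζ => (φ ζ).2) 0) with hmin | hmin
    · refine le_max_of_le_left (le_trans ?_
        (div_order_le_typeAt ρ z₀ hφ.holomorphic.fst (by simp [hφ.map_zero])))
      rw [horder, hmin]
      exact ENNReal.div_le_div_right (mod_cast hleρ) _
    · refine le_max_of_le_right (le_trans ?_
        (div_order_le_typeAt h w₀ hφ.holomorphic.snd (by simp [hφ.map_zero])))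
      rw [horder, hmin]
      exact ENNReal.div_le_div_right (mod_cast hleh) _
  · simpa [hh₀] using typeAt_mk_left_le (fun p : E × F => ρ p.1 + h p.2) z₀ w₀
  · simpa [hρ₀] using typeAt_mk_right_le (fun p : E × F => ρ p.1 + h p.2) z₀ w₀

end TypeOfFunction

section Sublevel

variable {E F : Type*} [NormedAddCommGroup E] [NormedSpace ℝ E]
  [NormedAddCommGroup F] [NormedSpace ℝ F]

theorem mem_frontier_sublevel_iff {W : Set E} {r : E → ℝ} {x : E} (hW : IsOpen W)
    (hr : ContinuousOn r W) (hr' : fderiv ℝ r x ≠ 0) (hx : x ∈ W) :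
    x ∈ frontier {y | y ∈ W ∧ r y < 0} ↔ r x = 0 := by
  have hneg : IsOpen {y | y ∈ W ∧ r y < 0} := hr.isOpen_inter_preimage hW isOpen_Iio
  have hpos : IsOpen {y | y ∈ W ∧ 0 < r y} := hr.isOpen_inter_preimage hW isOpen_Ioi
  rw [hneg.frontier_eq]
  refine ⟨fun ⟨hclosure, hnot⟩ => ?_, fun hzero => ⟨?_, fun h => h.2.ne hzero⟩⟩
  · refine le_antisymm (not_lt.1 fun hlt => ?_) (not_lt.1 fun hlt => hnot ⟨hx, hlt⟩)
    obtain ⟨y, hy, hy'⟩ := mem_closure_iff.1 hclosure _ hpos ⟨hx, hlt⟩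
    exact lt_asymm hy.2 hy'.2
  · by_contra hclosure
    have hmin : IsLocalMin r x := by
      filter_upwards [isClosed_closure.isOpen_compl.mem_nhds hclosure, hW.mem_nhds hx]
        with y hy hyW
      rw [hzero]
      exact not_lt.1 fun hlt => hy (subset_closure ⟨hyW, hlt⟩)
    exact hr' hmin.fderiv_eq_zero

theorem isLocalDefiningFunction_frontier_sublevel {W : Set E} {r : E → ℝ} {p : E}
    (hW : IsOpen W) (hr : ContDiffOn ℝ ∞ r W) (hr' : ∀ x ∈ W, fderiv ℝ r x ≠ 0) (hp : p ∈ W)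
    (hrp : r p = 0) : IsLocalDefiningFunction (frontier {y | y ∈ W ∧ r y < 0}) p r :=
  have hmem x (hx : x ∈ W) := mem_frontier_sublevel_iff hW hr.continuousOn (hr' x hx) hx
  ⟨(hmem p hp).2 hrp, W, hW, hp, hr, hr', hmem⟩

theorem isLocalDefiningFunction_zeroSet {W : Set E} {r : E → ℝ} {p : E} (hW : IsOpen W)
    (hr : ContDiffOn ℝ ∞ r W) (hr' : ∀ x ∈ W, fderiv ℝ r x ≠ 0) (hp : p ∈ W) (hrp : r p = 0) :
    IsLocalDefiningFunction {x | x ∈ W ∧ r x = 0} p r :=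
  ⟨⟨hp, hrp⟩, W, hW, hp, hr, hr', fun _ hx => and_iff_right hx⟩

theorem fderiv_comp_fst_add_comp_snd_ne_zero {ρ : E → ℝ} {h : F → ℝ} {p : E × F}
    (hρ : DifferentiableAt ℝ ρ p.1) (hh : DifferentiableAt ℝ h p.2)
    (hρ' : fderiv ℝ ρ p.1 ≠ 0) : fderiv ℝ (fun p : E × F => ρ p.1 + h p.2) p ≠ 0 := by
  intro hzero
  refine hρ' (ContinuousLinearMap.ext fun v => ?_)
  have hsum := (hρ.hasFDerivAt.comp p hasFDerivAt_fst).add (hh.hasFDerivAt.comp p hasFDerivAt_snd)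
  simpa using congrArg (fun L => L (v, 0)) (hsum.fderiv.symm.trans hzero)

theorem isLocalDefiningFunction_frontier_sublevel_add {U : Set E} {V : Set F} {ρ : E → ℝ}
    {h : F → ℝ} {z₀ : E} {w₀ : F} (hU : IsOpen U) (hV : IsOpen V) (hρ : ContDiffOn ℝ ∞ ρ U)
    (hh : ContDiffOn ℝ ∞ h V) (hρ' : ∀ z ∈ U, fderiv ℝ ρ z ≠ 0) (hz₀ : z₀ ∈ U) (hw₀ : w₀ ∈ V)
    (hzero : ρ z₀ + h w₀ = 0) :
    IsLocalDefiningFunction (frontier {p : E × F | (p.1 ∈ U ∧ p.2 ∈ V) ∧ ρ p.1 + h p.2 < 0})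
      (z₀, w₀) fun p => ρ p.1 + h p.2 := by
  have hsum : ContDiffOn ℝ ∞ (fun p : E × F => ρ p.1 + h p.2) (U ×ˢ V) :=
    (hρ.comp contDiffOn_fst fun _ hp => hp.1).add (hh.comp contDiffOn_snd fun _ hp => hp.2)
  refine isLocalDefiningFunction_frontier_sublevel (hU.prod hV) hsum (fun p hp => ?_) ⟨hz₀, hw₀⟩
    hzero
  exact fderiv_comp_fst_add_comp_snd_ne_zero
    ((hρ.contDiffAt (hU.mem_nhds hp.1)).differentiableAt (by simp))
    ((hh.contDiffAt (hV.mem_nhds hp.2)).differentiableAt (by simp)) (hρ' p.1 hp.1)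

end Sublevel

end FiniteType

end

theorem mainTheorem6_general {E F : Type*} [NormedAddCommGroup E] [NormedSpace ℝ E]
    [NormedSpace ℂ E] [IsScalarTower ℝ ℂ E] [CompleteSpace E] [NormedAddCommGroup F]
    [NormedSpace ℝ F] [NormedSpace ℂ F] [IsScalarTower ℝ ℂ F] [CompleteSpace F]
    {z₀ : E} {w₀ : F} {U : Set E} {V : Set F} (hU : IsOpen U) (hz₀ : z₀ ∈ U) (hV : IsOpen V)
    (hw₀ : w₀ ∈ V) {ρ : E → ℝ} (hρ : ContDiffOn ℝ ∞ ρ U) (hρz₀ : ρ z₀ = 0)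
    (hρgrad : ∀ z ∈ U, fderiv ℝ ρ z ≠ 0) {h : F → ℝ} (hh : ContDiffOn ℝ ∞ h V)
    (hhnonneg : ∀ w ∈ V, 0 ≤ h w) (hhw₀ : h w₀ = 0)
    (hlevi : ∀ z ∈ U, ρ z = 0 → ∀ v, FiniteType.IsComplexTangent ρ z v →
      0 ≤ FiniteType.leviForm ρ z v)
    {τ : ℝ≥0∞} (hτ : FiniteType.IsOfFiniteType {z | z ∈ U ∧ ρ z = 0} z₀ τ)
    (htyp : FiniteType.typeAt h w₀ < ⊤) :
    FiniteType.IsOfFiniteType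
      (frontier {p : E × F | (p.1 ∈ U ∧ p.2 ∈ V) ∧ ρ p.1 + h p.2 < 0})
      (z₀, w₀) (max τ (FiniteType.typeAt h w₀)) := by
  have hUz₀ := hU.mem_nhds hz₀
  have hVw₀ := hV.mem_nhds hw₀
  have hτρ : FiniteType.typeAt ρ z₀ = τ :=
    hτ.2.2 ρ (FiniteType.isLocalDefiningFunction_zeroSet hU hρ hρgrad hz₀ hρz₀)
  have hdef := FiniteType.isLocalDefiningFunction_frontier_sublevel_add hU hV hρ hh hρgrad hz₀ hw₀
    (by rw [hρz₀, hhw₀, add_zero])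
  refine ⟨max_lt hτ.1 htyp, ⟨_, hdef⟩, fun r hr => ?_⟩
  rw [hr.typeAt_eq hdef, ← hτρ]
  exact FiniteType.typeAt_add (hρ.contDiffAt hUz₀) hρz₀ (hρgrad z₀ hz₀)
    (Filter.mem_of_superset hUz₀ hlevi) (hh.contDiffAt hVw₀) hhw₀
    (Filter.mem_of_superset hVw₀ hhnonneg)

theorem mainTheorem6 (n m : ℕ)
    (z₀ : EuclideanSpace ℂ (Fin n))
    (U : Set (EuclideanSpace ℂ (Fin n))) (hU : IsOpen U) (hz₀U : z₀ ∈ U)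
    (V : Set (EuclideanSpace ℂ (Fin m))) (hV : IsOpen V) (h0V : (0 : EuclideanSpace ℂ (Fin m)) ∈ V)
    (ρ : EuclideanSpace ℂ (Fin n) → ℝ) (hρ : ContDiffOn ℝ ∞ ρ U)
    (hρz₀ : ρ z₀ = 0) (hρgrad : ∀ z ∈ U, fderiv ℝ ρ z ≠ 0)
    (h : EuclideanSpace ℂ (Fin m) → ℝ) (hh : ContDiffOn ℝ ∞ h V)
    (hhnonneg : ∀ w ∈ V, 0 ≤ h w)
    (hhgrad : ∀ w ∈ V, w ≠ 0 → fderiv ℝ h w ≠ 0)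
    (hhzero : ∀ w ∈ V, (h w ≠ 0 ↔ w ≠ 0))
    (hLevi : ∀ z ∈ U, ρ z = 0 → ∀ v : EuclideanSpace ℂ (Fin n),
      FiniteType.IsComplexTangent ρ z v → 0 ≤ FiniteType.leviForm ρ z v)
    (τ : ℝ≥0∞) (hτ : FiniteType.IsOfFiniteType {z | z ∈ U ∧ ρ z = 0} z₀ τ)
    (htyp : FiniteType.typeAt h 0 < ⊤) :
    FiniteType.IsOfFiniteType
      (frontier {p : EuclideanSpace ℂ (Fin n) × EuclideanSpace ℂ (Fin m) |
        (p.1 ∈ U ∧ p.2 ∈ V) ∧ ρ p.1 + h p.2 < 0})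
      (z₀, 0) (max τ (FiniteType.typeAt h 0)) := by
  exact mainTheorem6_general hU hz₀U hV h0V hρ hρz₀ hρgrad hh hhnonneg
    (not_not.1 fun hne => (hhzero 0 h0V).1 hne rfl) hLevi hτ htyp
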